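/- Let $\ell^\infty=\ell^\infty(\mathbb N)$ be the space of bounded real sequences with the supremum norm $|\cdot|$, and let $B(x,r)=\{y\in\ell^\infty:|x-y|<r\}$. For a set $X\subseteq \ell^\infty$, a point $x\in X$ and $r>0$ define $$\beta'_X(x,r)=\inf_{s}\ \frac{\ell(s)-|s(0)-s(1)|+\sup_{z\in X\cap B(x,r)}\operatorname{dist}\bigl(z,s([0,1])\bigr)}{|s(0)-s(1)|},$$ where the infimum is over all continuous curves $s:[0,1]\to B(x,r)$ with $s(0)\neq s(1)$, and $\ell(s)=\sup\sum_{i=0}^{n-1}|s(t_i)-s(t_{i+1})|\in[0,\infty]$, the supremum being over all partitions $0=t_0<t_1<\dots<t_n=1$, is the length of $s$. **Theorem.** There is a universal constant $c_0>0$ with the following property. Let $X$ be a nonempty compact connected metric space, regarded as a subset of $\ell^\infty$ through any isometric embedding. If $\beta>0$ and $r_0>0$ are such that $\beta'_X(x,r)>\beta$ for every $x\in X$ and every $r\in(0,r_0)$, then the Hausdorff dimension of $X$ satisfies $\dim X\geq 1+c_0\beta^2$. -/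

import Mathlib

open scoped ENNReal

/-- The real Banach space `ℓ^∞` of bounded sequences indexed by `ℕ`, with the sup norm. -/
abbrev EllInfty : Type := lp (fun _ : ℕ => ℝ) ∞

/-- The length `ℓ(s)` of a curve `s` parametrized by `[0,1]`: the supremum over all partitions
of `[0,1]` of the sums of the distances between consecutive points (possibly `∞`). -/
noncomputable def curveLength {E : Type*} [PseudoEMetricSpace E] (s : ℝ → E) : ℝ≥0∞ :=
  eVariationOn s (Set.Icc 0 1)

/-- The admissible curves for the ball `B(x,r)`: continuous maps `s : [0,1] → B(x,r)` into the
open ball (values of `s` outside `[0,1]` play no role) with distinct end points, so that the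
quotient in `betaPrime` makes sense. -/
structure IsAdmissibleCurve {E : Type*} [MetricSpace E] (x : E) (r : ℝ) (s : ℝ → E) : Prop where
  continuousOn : ContinuousOn s (Set.Icc 0 1)
  mapsTo : Set.MapsTo s (Set.Icc 0 1) (Metric.ball x r)
  endpoints_ne : s 0 ≠ s 1

/-- The number `β'_K(x,r)`: the infimum over all curves `s : [0,1] → B(x,r)` of
`(ℓ(s) - |s(0) - s(1)| + sup_{z ∈ K ∩ B(x,r)} dist(z, s([0,1]))) / |s(0) - s(1)|`.
It is computed in `[0,∞]`, so that curves of infinite length contribute `∞`; the subtraction is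
never truncated, since `|s(0) - s(1)| ≤ ℓ(s)` and `|s(0) - s(1)| < ∞`. -/
noncomputable def betaPrime {E : Type*} [MetricSpace E] (K : Set E) (x : E) (r : ℝ) : ℝ≥0∞ :=
  ⨅ (s : ℝ → E) (_ : IsAdmissibleCurve x r s),
    (curveLength s - edist (s 0) (s 1)
        + ⨆ z ∈ K ∩ Metric.ball x r, Metric.infEDist z (s '' Set.Icc 0 1))
      / edist (s 0) (s 1)

/-! Call a closed set a piece of width `w` if a function that is 1-Lipschitz on it maps it into an
interval of length `w`, no splitting into two disjoint closed sets separates the bottom level from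
the top one, and its points can leave it only through these levels. At small scales each piece
contains pieces of widths between `δ w` and `7/8 w`, mutually `δ w` apart, of total width at least
`(1 + ε) w`, with `δ ≈ β²` and `ε ≈ β` (`hasSubdivision_of_isWiggly`). Iteration gives dimension at
least `1 + σ` once `(1 + ε) δ ^ σ ≥ 1` (`le_dimH_of_hasSubdivision`), and a small multiple of `β²`
is such a `σ`.

To subdivide, consider chains with steps `t ≈ β w` from bottom to top. If all have length at least
`(1 + β / 2 ^ 13) w`, slabs of the chain distance with narrow gaps between them suffice. Otherwise
some chain is almost geodesic, and `β'` yields a point `z` far from its middle part, which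
nevertheless passes close to the level of `z`. A thin slab around this level then holds more total
width than its height: either many disjoint balls, or a part that still crosses the slab together
with a ball away from it.

The ambient space serves only to turn chains into curves and to bound `β`; the rest is intrinsic to
`X`. -/

/-! ### Polygons in a normed space: from curves to chains. -/

section Polygon
variable {E : Type*} [NormedAddCommGroup E] [NormedSpace ℝ E]

/-- The polygonal curve with vertices `u 0, u 1, …`, passing through `u k` at time `k`. -/
noncomputable def polygon (u : ℕ → E) (t : ℝ) : E :=
  AffineMap.lineMap (u ⌊t⌋₊) (u (⌊t⌋₊ + 1)) (t - ⌊t⌋₊)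

theorem polygon_natCast (u : ℕ → E) (k : ℕ) : polygon u k = u k := by
  simp [polygon]

theorem polygon_eqOn (u : ℕ → E) (k : ℕ) :
    Set.EqOn (polygon u) (fun t => AffineMap.lineMap (u k) (u (k + 1)) (t - k))
      (Set.Icc (k : ℝ) (k + 1 : ℕ)) := by
  intro t ht
  rcases eq_or_lt_of_le ht.2 with h | h
  · rw [h, polygon_natCast]
    simp
  · have : ⌊t⌋₊ = k := by
      rw [Nat.floor_eq_iff ((Nat.cast_nonneg k).trans ht.1)]
      exact ⟨ht.1, by simpa using h⟩
    simp [polygon, this]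

theorem lipschitzWith_lineMap_sub (p q : E) (c : ℝ) :
    LipschitzWith (nndist p q) (fun t : ℝ => AffineMap.lineMap p q (t - c)) := by
  refine LipschitzWith.of_dist_le_mul fun x y => ?_
  simp [dist_lineMap_lineMap, mul_comm]

theorem continuousOn_polygon (u : ℕ → E) (n : ℕ) :
    ContinuousOn (polygon u) (Set.Icc 0 (n : ℝ)) := by
  induction n with
  | zero => simp
  | succ k ih =>
    have h1 : ContinuousOn (polygon u) (Set.Icc (k : ℝ) (k + 1 : ℕ)) :=
      (lipschitzWith_lineMap_sub _ _ _).continuous.continuousOn.congr (polygon_eqOn u k)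
    have := ih.union_of_isClosed h1 isClosed_Icc isClosed_Icc
    rwa [Set.Icc_union_Icc_eq_Icc (Nat.cast_nonneg k) (by simp)] at this

theorem eVariationOn_polygon_le (u : ℕ → E) (n : ℕ) :
    eVariationOn (polygon u) (Set.Icc 0 (n : ℝ)) ≤
      ENNReal.ofReal (∑ i ∈ Finset.range n, dist (u i) (u (i + 1))) := by
  induction n with
  | zero => simp [eVariationOn.subsingleton]
  | succ k ih =>
    have hk : (k : ℝ) ≤ (k + 1 : ℕ) := by simp
    have h0 : (0 : ℝ) ≤ k := Nat.cast_nonneg k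
    have h1 := eVariationOn.Icc_add_Icc (polygon u) (s := Set.univ) h0 hk (Set.mem_univ _)
    simp only [Set.univ_inter] at h1
    rw [← h1, Finset.sum_range_succ, ENNReal.ofReal_add
      (Finset.sum_nonneg fun _ _ => dist_nonneg) dist_nonneg]
    refine add_le_add ih ?_
    rw [eVariationOn.congr (polygon_eqOn u k)]
    have h2 := (lipschitzWith_lineMap_sub (u k) (u (k + 1)) k).lipschitzOnWith
      (s := Set.univ) |>.comp_eVariationOn_le (g := id) (s := Set.Icc (k : ℝ) (k + 1 : ℕ))
      (fun _ _ => Set.mem_univ _)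
    refine h2.trans ?_
    have h3 : eVariationOn (id : ℝ → ℝ) (Set.Icc (k : ℝ) (k + 1 : ℕ)) ≤ 1 := by
      simp
    calc _ ≤ (nndist (u k) (u (k + 1)) : ℝ≥0∞) * 1 := by gcongr
      _ = _ := by rw [mul_one, ← edist_nndist, edist_dist]

theorem mapsTo_polygon {C : Set E} (hC : Convex ℝ C) {u : ℕ → E} {n : ℕ}
    (hu : ∀ i ≤ n, u i ∈ C) : Set.MapsTo (polygon u) (Set.Icc 0 (n : ℝ)) C := by
  intro t ht
  rcases eq_or_lt_of_le ht.2 with h | h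
  · rw [h, polygon_natCast]
    exact hu n le_rfl
  · have h1 : ⌊t⌋₊ < n := by rwa [Nat.floor_lt ht.1]
    refine hC.lineMap_mem (hu _ h1.le) (hu _ h1) ⟨?_, ?_⟩
    · linarith [Nat.floor_le ht.1]
    · linarith [Nat.lt_floor_add_one t]

/-- A finite chain of points in a ball, almost as short as the distance of its end points, stays
far from some point of `K` in this ball whenever `β'` is large there. -/
theorem exists_far_from_chain {K : Set E} {x : E} {r β : ℝ} (hβ : 0 ≤ β)
    (hK : ENNReal.ofReal β < betaPrime K x r) {u : ℕ → E} {n : ℕ}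
    (hu : ∀ i ≤ n, dist (u i) x < r) {d η κ : ℝ} (hd : 0 < d) (hη : 0 ≤ η) (hκ : 0 ≤ κ)
    (hdist : d ≤ dist (u 0) (u n))
    (hlen : ∑ i ∈ Finset.range n, dist (u i) (u (i + 1)) ≤ dist (u 0) (u n) + η)
    (hsum : η + κ ≤ β * d) :
    ∃ z ∈ K, dist z x < r ∧ ∀ i ≤ n, κ < dist z (u i) := by
  by_contra hcon
  push Not at hcon
  refine hK.not_ge ?_
  have hmono : Monotone fun t : ℝ => (n : ℝ) * t := fun a b hab => by
    simp only; gcongr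
  have hmaps : Set.MapsTo (fun t : ℝ => (n : ℝ) * t) (Set.Icc 0 1) (Set.Icc 0 (n : ℝ)) :=
    fun t ht => ⟨mul_nonneg (Nat.cast_nonneg n) ht.1,
      mul_le_of_le_one_right (Nat.cast_nonneg n) ht.2⟩
  -- The competitor in the infimum is the polygon through the chain, which stays in the ball by
  -- convexity.
  set s : ℝ → E := polygon u ∘ fun t : ℝ => (n : ℝ) * t with hs
  have s0 : s 0 = u 0 := by
    have := polygon_natCast u 0
    simpa [hs] using this
  have s1 : s 1 = u n := by simp [hs, polygon_natCast]
  have hpos : 0 < dist (u 0) (u n) := hd.trans_le hdist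
  have hadm : IsAdmissibleCurve x r s := by
    refine ⟨(continuousOn_polygon u n).comp (by fun_prop) hmaps, ?_, ?_⟩
    · exact (mapsTo_polygon (convex_ball x r) fun i hi => hu i hi).comp hmaps
    · rw [s0, s1]
      exact dist_pos.1 hpos
  refine (iInf₂_le s hadm).trans ?_
  rw [s0, s1]
  have hL : curveLength s ≤ ENNReal.ofReal (dist (u 0) (u n) + η) :=
    ((eVariationOn.comp_le_of_monotoneOn (polygon u) _ (hmono.monotoneOn _) hmaps).trans
      (eVariationOn_polygon_le u n)).trans (ENNReal.ofReal_le_ofReal hlen)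
  have h1 : curveLength s - edist (u 0) (u n) ≤ ENNReal.ofReal η := by
    rw [tsub_le_iff_right, edist_dist, ← ENNReal.ofReal_add hη dist_nonneg, add_comm η]
    exact hL
  have h2 : (⨆ z ∈ K ∩ Metric.ball x r, Metric.infEDist z (s '' Set.Icc 0 1)) ≤
      ENNReal.ofReal κ := by
    refine iSup₂_le fun z hz => ?_
    obtain ⟨i, hi, hzi⟩ := hcon z hz.1 hz.2
    have hmem : u i ∈ s '' Set.Icc 0 1 := by
      rcases Nat.eq_zero_or_pos n with h0 | h0
      · obtain rfl : i = 0 := by omega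
        exact ⟨0, by simp, s0⟩
      · have hn : (0 : ℝ) < n := by exact_mod_cast h0
        refine ⟨(i : ℝ) / n, ⟨by positivity, ?_⟩, ?_⟩
        · rw [div_le_one hn]
          exact_mod_cast hi
        · simp only [hs, Function.comp_apply]
          rw [mul_div_cancel₀ _ hn.ne', polygon_natCast]
    refine (Metric.infEDist_le_edist_of_mem hmem).trans ?_
    rw [edist_dist]
    exact ENNReal.ofReal_le_ofReal hzi
  refine ENNReal.div_le_of_le_mul ?_
  calc _ ≤ ENNReal.ofReal η + ENNReal.ofReal κ := add_le_add h1 h2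
    _ = ENNReal.ofReal (η + κ) := (ENNReal.ofReal_add hη hκ).symm
    _ ≤ ENNReal.ofReal (β * dist (u 0) (u n)) := ENNReal.ofReal_le_ofReal <| by
      refine hsum.trans (by gcongr)
    _ = _ := by rw [ENNReal.ofReal_mul hβ, edist_dist]

/-- In a nontrivial space, `β' > β` forces `β < 2`, and `K` is not the single point `x`. -/
theorem lt_two_of_lt_betaPrime [Nontrivial E] {K : Set E} {x : E} {r β : ℝ} (hr : 0 < r)
    (hβ : 0 ≤ β) (hK : ENNReal.ofReal β < betaPrime K x r) :
    β < 2 ∧ ∃ z ∈ K, z ≠ x := by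
  obtain ⟨e, he⟩ := exists_norm_eq E (c := r / 2) (by positivity)
  set u : ℕ → E := fun i => if i = 0 then x else x + e with hu
  have hu01 : dist (u 0) (u 1) = r / 2 := by simp [hu, he]
  have hur : ∀ i ≤ 1, dist (u i) x < r := by
    intro i hi
    interval_cases i
    · simpa [hu] using hr
    · simp only [hu, one_ne_zero, if_false, dist_self_add_left, he]; linarith
  constructor
  · by_contra! h2
    -- For `β ≥ 2` the value `κ = r` is allowed, but no point of the ball is farther than `r` from
    -- its centre `u 0`.
    obtain ⟨z, -, hz, hfar⟩ := exists_far_from_chain hβ hK (n := 1) hur (d := r / 2) (η := 0)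
      (κ := r) (by positivity) le_rfl hr.le hu01.ge (by simp) (by nlinarith)
    have := hfar 0 (by norm_num)
    simp only [hu, if_true] at this
    linarith
  · obtain ⟨z, hzK, -, hfar⟩ := exists_far_from_chain hβ hK (n := 1) hur (d := r / 2) (η := 0)
      (κ := 0) (by positivity) le_rfl le_rfl hu01.ge (by simp) (by rw [add_zero]; positivity)
    have := hfar 0 (by norm_num)
    simp only [hu, if_true] at this
    exact ⟨z, hzK, dist_pos.1 this⟩

end Polygon

/-! ### Crossings: slabs, balls and splitting. -/

section Crossing
variable {X : Type*} [MetricSpace X]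

/-- `Q` is not the disjoint union of a closed set containing the `a`-level of `f` and a closed set
containing its `b`-level. -/
def IsUnseparated (Q : Set X) (f : X → ℝ) (a b : ℝ) : Prop :=
  ∀ A B : Set X, IsClosed A → IsClosed B → Disjoint A B → A ∪ B = Q →
    (∀ x ∈ Q, f x ≤ a → x ∈ A) → (∀ x ∈ Q, b ≤ f x → x ∈ B) → False

/-- The set `Q` is crossed by the space from the `a`-level to the `b`-level of the `1`-Lipschitz
function `f`, and its points in between can leave `Q` only through these levels. -/
structure IsCrossing (Q : Set X) (f : X → ℝ) (a b : ℝ) : Prop where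
  lt : a < b
  isClosed : IsClosed Q
  abs_sub_le : ∀ x ∈ Q, ∀ y ∈ Q, |f x - f y| ≤ dist x y
  mem_Icc : ∀ x ∈ Q, f x ∈ Set.Icc a b
  interior : ∀ x ∈ Q, ∀ y, dist x y < f x - a → dist x y < b - f x → y ∈ Q
  unseparated : IsUnseparated Q f a b

/-- A set carrying a crossing of width `w`. -/
def IsPiece (Q : Set X) (w : ℝ) : Prop :=
  ∃ f a b, IsCrossing Q f a b ∧ b - a = w

theorem IsPiece.pos {Q : Set X} {w : ℝ} (h : IsPiece Q w) : 0 < w := by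
  obtain ⟨f, a, b, h, rfl⟩ := h
  exact sub_pos.2 h.lt

theorem IsUnseparated.nonempty {Q : Set X} {f : X → ℝ} {a b : ℝ} (h : IsUnseparated Q f a b) :
    Q.Nonempty := by
  by_contra hQ
  rw [Set.not_nonempty_iff_eq_empty] at hQ
  subst hQ
  exact h ∅ ∅ isClosed_empty isClosed_empty (by simp) (by simp) (by simp) (by simp)

theorem IsPiece.nonempty {Q : Set X} {w : ℝ} (h : IsPiece Q w) : Q.Nonempty := by
  obtain ⟨f, a, b, h, rfl⟩ := h
  exact h.unseparated.nonempty

/-- A separation of the slab extends to one of `Q`: the points with `h ≤ a'` join the lower part,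
those with `h ≥ b'` the upper part. -/
theorem IsUnseparated.slab {Q : Set X} {f h : X → ℝ} {a b a' b' : ℝ}
    (hQ : IsUnseparated Q f a b) (hQc : IsClosed Q) (hc : ContinuousOn h Q) (hab : a' < b')
    (ha : ∀ x ∈ Q, f x ≤ a → h x ≤ a') (hb : ∀ x ∈ Q, b ≤ f x → b' ≤ h x) :
    IsUnseparated (Q ∩ h ⁻¹' Set.Icc a' b') h a' b' := by
  intro A B hA hB hAB hU hA' hB'
  have hlow : IsClosed (Q ∩ h ⁻¹' Set.Iic a') := hc.preimage_isClosed_of_isClosed hQc isClosed_Iic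
  have hhigh : IsClosed (Q ∩ h ⁻¹' Set.Ici b') := hc.preimage_isClosed_of_isClosed hQc isClosed_Ici
  have hAQ : ∀ x ∈ A, x ∈ Q ∩ h ⁻¹' Set.Icc a' b' := fun x hx => hU ▸ Or.inl hx
  have hBQ : ∀ x ∈ B, x ∈ Q ∩ h ⁻¹' Set.Icc a' b' := fun x hx => hU ▸ Or.inr hx
  have hd : ∀ x ∈ A, x ∉ B := fun x h1 h2 => Set.disjoint_left.1 hAB h1 h2
  refine hQ ((Q ∩ h ⁻¹' Set.Iic a') ∪ A) ((Q ∩ h ⁻¹' Set.Ici b') ∪ B) (hlow.union hA)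
    (hhigh.union hB) ?_ ?_ ?_ ?_
  · rw [Set.disjoint_left]
    rintro x (⟨hxQ, hx⟩ | hx) (⟨-, hx'⟩ | hx')
    · exact (lt_irrefl _ (hab.trans_le (le_trans hx' hx)))
    · have := hBQ x hx'
      exact hd x (hA' x this hx) hx'
    · have := hAQ x hx
      exact hd x hx (hB' x this hx')
    · exact hd x hx hx'
  · ext x
    constructor
    · rintro ((h1 | h1) | (h1 | h1))
      exacts [h1.1, (hAQ x h1).1, h1.1, (hBQ x h1).1]
    · intro hx
      by_cases h1 : h x ≤ a'
      · exact Or.inl (Or.inl ⟨hx, h1⟩)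
      by_cases h2 : b' ≤ h x
      · exact Or.inr (Or.inl ⟨hx, h2⟩)
      have : x ∈ A ∪ B := by
        rw [hU]
        exact ⟨hx, (not_le.1 h1).le, (not_le.1 h2).le⟩
      exact this.imp Or.inr Or.inr
  · exact fun x hx hxa => Or.inl ⟨hx, ha x hx hxa⟩
  · exact fun x hx hxb => Or.inl ⟨hx, hb x hx hxb⟩

/-- Slabs between two levels of a locally `1`-Lipschitz function. -/
theorem IsCrossing.slab {Q : Set X} {f h : X → ℝ} {a b a' b' : ℝ} (hQ : IsCrossing Q f a b)
    (hab : a' < b')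
    (hlip : ∀ x ∈ Q, ∀ y ∈ Q, dist x y ≤ b' - a' → |h x - h y| ≤ dist x y)
    (ha : ∀ x ∈ Q, f x ≤ a → h x ≤ a') (hb : ∀ x ∈ Q, b ≤ f x → b' ≤ h x)
    (hdeep : ∀ x ∈ Q, ∀ d, d < h x - a' → d < b' - h x → d < f x - a ∧ d < b - f x) :
    IsCrossing (Q ∩ h ⁻¹' Set.Icc a' b') h a' b' := by
  have hc : ContinuousOn h Q := by
    rw [Metric.continuousOn_iff]
    intro x hx ε hε
    refine ⟨min ε (b' - a'), lt_min hε (sub_pos.2 hab), fun y hy hyx => ?_⟩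
    rw [lt_min_iff] at hyx
    exact (hlip y hy x hx hyx.2.le).trans_lt hyx.1
  refine ⟨hab, hc.preimage_isClosed_of_isClosed hQ.isClosed isClosed_Icc, ?_, fun x hx => hx.2, ?_,
    hQ.unseparated.slab hQ.isClosed hc hab ha hb⟩
  · rintro x ⟨hx, hx1⟩ y ⟨hy, hy1⟩
    -- Beyond the scale where `h` is Lipschitz the bound is trivial, since both values lie in an
    -- interval of length `b' - a'`.
    rcases le_total (dist x y) (b' - a') with h1 | h1
    · exact hlip x hx y hy h1
    · refine le_trans ?_ h1
      rw [abs_le]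
      constructor <;> linarith [hx1.1, hx1.2, hy1.1, hy1.2]
  · rintro x ⟨hx, hx1⟩ y h1 h2
    obtain ⟨h3, h4⟩ := hdeep x hx _ h1 h2
    have hy := hQ.interior x hx y h3 h4
    have := abs_le.1 (hlip x hx y hy (by linarith [hx1.1, hx1.2]))
    exact ⟨hy, by linarith [this.2], by linarith [this.1]⟩

/-- Slabs between two levels of the same function. -/
theorem IsCrossing.restrict {Q : Set X} {f : X → ℝ} {a b a' b' : ℝ} (hQ : IsCrossing Q f a b)
    (ha : a ≤ a') (hab : a' < b') (hb : b' ≤ b) :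
    IsCrossing (Q ∩ f ⁻¹' Set.Icc a' b') f a' b' :=
  hQ.slab hab (fun x hx y hy _ => hQ.abs_sub_le x hx y hy) (fun _ _ h => h.trans ha)
    (fun _ _ h => hb.trans h) fun x _ d h1 h2 => ⟨by linarith, by linarith⟩

/-- Balls in a connected space. -/
theorem isCrossing_closedBall [PreconnectedSpace X] {z w : X} {ρ : ℝ} (hρ : 0 < ρ)
    (hw : ρ < dist w z) : IsCrossing (Metric.closedBall z ρ) (fun x => dist x z) 0 ρ := by
  refine ⟨hρ, Metric.isClosed_closedBall, fun x _ y _ => abs_dist_sub_le x y z,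
    fun x hx => ⟨dist_nonneg, hx⟩, fun x hx y _ h2 => ?_, ?_⟩
  · rw [Metric.mem_closedBall]
    linarith [dist_triangle_left y z x]
  · intro A B hA hB hAB hU hA' hB'
    have hz : z ∈ A := hA' z (by simp [hρ.le]) (by simp)
    -- The sphere belongs to `B`, so `A` is also open; by connectedness it is the whole space,
    -- although `w` lies outside the ball.
    have hAeq : A = Metric.ball z ρ ∩ Bᶜ := by
      ext x
      constructor
      · intro hx
        have hxB : x ∉ B := fun h => Set.disjoint_left.1 hAB hx h
        have hxQ : x ∈ Metric.closedBall z ρ := hU ▸ Or.inl hx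
        refine ⟨?_, hxB⟩
        by_contra hn
        exact hxB (hB' x hxQ (by simpa using hn))
      · rintro ⟨h1, h2⟩
        have : x ∈ A ∪ B := hU ▸ Metric.ball_subset_closedBall h1
        exact this.resolve_right h2
    have hAo : IsOpen A := hAeq ▸ Metric.isOpen_ball.inter hB.isOpen_compl
    have := IsClopen.eq_univ ⟨hA, hAo⟩ ⟨z, hz⟩
    have hwA : w ∈ Metric.closedBall z ρ := hU ▸ Or.inl (this ▸ Set.mem_univ w)
    exact absurd hwA (by simpa using hw)

/-- If a crossing splits into two parts at distance at least `(b - a) / 2`, one of the parts is a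
crossing. -/
theorem IsCrossing.split {M A B : Set X} {f : X → ℝ} {a b : ℝ} (hM : IsCrossing M f a b)
    (hA : IsClosed A) (hB : IsClosed B) (hU : A ∪ B = M)
    (hd : ∀ x ∈ A, ∀ y ∈ B, (b - a) / 2 ≤ dist x y) :
    IsCrossing A f a b ∨ IsCrossing B f a b := by
  have hAM : ∀ x ∈ A, x ∈ M := fun x hx => hU ▸ Or.inl hx
  have hBM : ∀ x ∈ B, x ∈ M := fun x hx => hU ▸ Or.inr hx
  have hAB : ∀ x ∈ A, x ∉ B := fun x hx hx' => by
    have := hd x hx x hx'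
    rw [dist_self] at this
    linarith [hM.lt]
  have key : IsUnseparated A f a b ∨ IsUnseparated B f a b := by
    by_contra! hcon
    obtain ⟨h1, h2⟩ := hcon
    simp only [IsUnseparated, not_forall] at h1 h2
    obtain ⟨A₁, A₂, c1, c2, d1, u1, l1, l2, -⟩ := h1
    obtain ⟨B₁, B₂, e1, e2, d2, u2, m1, m2, -⟩ := h2
    have hA₁ : A₁ ⊆ A := u1 ▸ Set.subset_union_left
    have hA₂ : A₂ ⊆ A := u1 ▸ Set.subset_union_right
    have hB₁ : B₁ ⊆ B := u2 ▸ Set.subset_union_left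
    have hB₂ : B₂ ⊆ B := u2 ▸ Set.subset_union_right
    have dAB : Disjoint A B := Set.disjoint_left.2 hAB
    refine hM.unseparated (A₁ ∪ B₁) (A₂ ∪ B₂) (c1.union e1) (c2.union e2) ?_ ?_ ?_ ?_
    · rw [Set.disjoint_union_left, Set.disjoint_union_right, Set.disjoint_union_right]
      exact ⟨⟨d1, dAB.mono hA₁ hB₂⟩, (dAB.mono hA₂ hB₁).symm, d2⟩
    · rw [Set.union_union_union_comm, u1, u2, hU]
    · intro x hx hxa
      rw [← hU] at hx
      exact hx.imp (fun h => l1 x h hxa) (fun h => m1 x h hxa)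
    · intro x hx hxa
      rw [← hU] at hx
      exact hx.imp (fun h => l2 x h hxa) (fun h => m2 x h hxa)
  refine key.imp (fun h => ?_) (fun h => ?_)
  · refine ⟨hM.lt, hA, fun x hx y hy => hM.abs_sub_le x (hAM x hx) y (hAM y hy),
      fun x hx => hM.mem_Icc x (hAM x hx), fun x hx y h1 h2 => ?_, h⟩
    have hy := hM.interior x (hAM x hx) y h1 h2
    rw [← hU] at hy
    refine hy.resolve_right fun hyB => ?_
    -- `dist x y` is below both `f x - a` and `b - f x`, hence below `(b - a) / 2`.
    linarith [hd x hx y hyB]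
  · refine ⟨hM.lt, hB, fun x hx y hy => hM.abs_sub_le x (hBM x hx) y (hBM y hy),
      fun x hx => hM.mem_Icc x (hBM x hx), fun x hx y h1 h2 => ?_, h⟩
    have hy := hM.interior x (hBM x hx) y h1 h2
    rw [← hU] at hy
    refine hy.resolve_left fun hyA => ?_
    have := hd y hyA x hx
    rw [dist_comm] at this
    linarith

end Crossing

/-! ### Lower bound for the Hausdorff dimension from subdivisions. -/

section Covering
variable {X : Type*} [MetricSpace X]

/-- `Q` contains finitely many members of `P`, at mutual distance at least `δ * w`, with widths in
`[δ * w, θ * w]` of sum at least `(1 + ε) * w`. -/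
def HasSubdivision (P : Set X → ℝ → Prop) (δ θ ε : ℝ) (Q : Set X) (w : ℝ) : Prop :=
  ∃ (I : Type) (_ : Fintype I) (Q' : I → Set X) (w' : I → ℝ),
    (∀ i, P (Q' i) (w' i)) ∧ (∀ i, Q' i ⊆ Q) ∧ (∀ i, δ * w ≤ w' i) ∧ (∀ i, w' i ≤ θ * w) ∧
    (∀ i j, i ≠ j → ∀ x ∈ Q' i, ∀ y ∈ Q' j, δ * w ≤ dist x y) ∧ (1 + ε) * w ≤ ∑ i, w' i

/-- If some `r j ≥ δ w`, its term alone suffices. Otherwise each `U j` meets at most one subpiece,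
so the cover splits into disjoint subcovers of the subpieces, to which induction applies, and `∑ w'
^ (1 + σ) ≥ (δ w) ^ σ ∑ w' ≥ w ^ (1 + σ)`. The number `n` bounds the generations before the widths
drop to `m`, where the first case must occur. -/
theorem rpow_le_sum_of_subset_iUnion {P : Set X → ℝ → Prop} {w₀ δ θ ε σ : ℝ}
    (hδ : 0 < δ) (hθ : 0 < θ) (hσ : 0 ≤ σ)
    (hgain : 1 ≤ (1 + ε) * δ ^ σ)
    (hpos : ∀ Q w, P Q w → 0 < w) (hne : ∀ Q w, P Q w → Q.Nonempty)
    (hsub : ∀ Q w, P Q w → w ≤ w₀ → HasSubdivision P δ θ ε Q w) (hθ1 : θ ≤ 1)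
    {J : Type*} (U : J → Set X) (r : J → ℝ) (hr : ∀ j, 0 < r j)
    (hU : ∀ j, ∀ x ∈ U j, ∀ y ∈ U j, dist x y ≤ r j) (m : ℝ) (n : ℕ) :
    ∀ (Q : Set X) (w : ℝ) (T : Finset J), P Q w → w ≤ w₀ → Q ⊆ ⋃ j ∈ T, U j →
      (∀ j ∈ T, m ≤ r j / δ) → θ ^ n * w ≤ m →
      w ^ (1 + σ) ≤ ∑ j ∈ T, (r j / δ) ^ (1 + σ) := by
  classical
  have hs : 0 ≤ 1 + σ := by linarith
  have hrδ : ∀ j, 0 < r j / δ := fun j => div_pos (hr j) hδ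
  have single : ∀ (w : ℝ) (T : Finset J), 0 < w → (∃ j ∈ T, w ≤ r j / δ) →
      w ^ (1 + σ) ≤ ∑ j ∈ T, (r j / δ) ^ (1 + σ) := by
    rintro w T hw ⟨j, hj, hwj⟩
    refine (Real.rpow_le_rpow hw.le hwj hs).trans ?_
    exact Finset.single_le_sum (f := fun j => (r j / δ) ^ (1 + σ))
      (fun i _ => Real.rpow_nonneg (hrδ i).le _) hj
  induction n with
  | zero =>
    intro Q w T hP _ hcov hm hwm
    obtain ⟨x, hx⟩ := hne Q w hP
    obtain ⟨j, hj, -⟩ := Set.mem_iUnion₂.1 (hcov hx)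
    refine single w T (hpos Q w hP) ⟨j, hj, ?_⟩
    rw [pow_zero, one_mul] at hwm
    exact hwm.trans (hm j hj)
  | succ n ih =>
    intro Q w T hP hw₀ hcov hm hwm
    have hw := hpos Q w hP
    by_cases hbig : ∃ j ∈ T, w ≤ r j / δ
    · exact single w T hw hbig
    push Not at hbig
    obtain ⟨I, _, Q', w', hP', hQ', hw1, hw2, hsep, hsum⟩ := hsub Q w hP hw₀
    set T' : I → Finset J := fun i => T.filter fun j => (U j ∩ Q' i).Nonempty with hT'
    have hTT : ∀ i, T' i ⊆ T := fun i => Finset.filter_subset _ _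
    have h1 : ∀ i, w' i ^ (1 + σ) ≤ ∑ j ∈ T' i, (r j / δ) ^ (1 + σ) := by
      intro i
      refine ih (Q' i) (w' i) (T' i) (hP' i) ((hw2 i).trans ?_) ?_ (fun j hj => hm j (hTT i hj)) ?_
      · nlinarith
      · intro x hx
        obtain ⟨j, hj, hxj⟩ := Set.mem_iUnion₂.1 (hcov (hQ' i hx))
        exact Set.mem_iUnion₂.2 ⟨j, Finset.mem_filter.2 ⟨hj, x, hxj, hx⟩, hxj⟩
      · refine le_trans ?_ hwm
        rw [pow_succ, mul_assoc]
        exact mul_le_mul_of_nonneg_left (hw2 i) (by positivity)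
    have hdisj : Set.PairwiseDisjoint (↑(Finset.univ : Finset I)) T' := by
      intro i _ k _ hik
      rw [Function.onFun, Finset.disjoint_left]
      intro j hj hj'
      obtain ⟨hjT, x, hxU, hxQ⟩ := Finset.mem_filter.1 hj
      obtain ⟨-, y, hyU, hyQ⟩ := Finset.mem_filter.1 hj'
      have h2 := hsep i k hik x hxQ y hyQ
      have h3 := hU j x hxU y hyU
      have h4 := hbig j hjT
      rw [div_lt_iff₀ hδ] at h4
      linarith
    calc w ^ (1 + σ) = w * w ^ σ := by rw [Real.rpow_add hw, Real.rpow_one]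
      _ ≤ ((1 + ε) * δ ^ σ) * (w * w ^ σ) := le_mul_of_one_le_left (by positivity) hgain
      _ = ((1 + ε) * w) * (δ * w) ^ σ := by rw [Real.mul_rpow hδ.le hw.le]; ring
      _ ≤ (∑ i, w' i) * (δ * w) ^ σ := by gcongr
      _ = ∑ i, w' i * (δ * w) ^ σ := Finset.sum_mul _ _ _
      _ ≤ ∑ i, w' i ^ (1 + σ) := by
        refine Finset.sum_le_sum fun i _ => ?_
        have hwi := hpos _ _ (hP' i)
        rw [Real.rpow_add hwi, Real.rpow_one]
        exact mul_le_mul_of_nonneg_left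
          (Real.rpow_le_rpow (by positivity) (hw1 i) hσ) hwi.le
      _ ≤ ∑ i, ∑ j ∈ T' i, (r j / δ) ^ (1 + σ) := Finset.sum_le_sum fun i _ => h1 i
      _ = ∑ j ∈ Finset.univ.biUnion T', (r j / δ) ^ (1 + σ) := (Finset.sum_biUnion hdisj).symm
      _ ≤ ∑ j ∈ T, (r j / δ) ^ (1 + σ) :=
        Finset.sum_le_sum_of_subset_of_nonneg
          (Finset.biUnion_subset.2 fun i _ => hTT i)
          fun j _ _ => Real.rpow_nonneg (hrδ j).le _

-- If the measure vanished, there would be a cover with a tiny sum of powers of diameters; thickened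
-- and made finite by compactness, it contradicts `rpow_le_sum_of_subset_iUnion`.
open MeasureTheory in
theorem le_dimH_of_hasSubdivision [CompactSpace X] {P : Set X → ℝ → Prop} {w₀ δ θ ε σ : ℝ}
    (hδ : 0 < δ) (hθ : 0 < θ) (hσ : 0 ≤ σ)
    (hgain : 1 ≤ (1 + ε) * δ ^ σ)
    (hpos : ∀ Q w, P Q w → 0 < w) (hne : ∀ Q w, P Q w → Q.Nonempty)
    (hclosed : ∀ Q w, P Q w → IsClosed Q)
    (hsub : ∀ Q w, P Q w → w ≤ w₀ → HasSubdivision P δ θ ε Q w) (hθ1 : θ < 1)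
    {Q : Set X} {w : ℝ} (hQ : P Q w) (hw₀ : w ≤ w₀) :
    ENNReal.ofReal (1 + σ) ≤ dimH (Set.univ : Set X) := by
  borelize X
  have hs : 0 < 1 + σ := by linarith
  have hw := hpos Q w hQ
  change ((Real.toNNReal (1 + σ) : NNReal) : ℝ≥0∞) ≤ _
  refine le_dimH_of_hausdorffMeasure_ne_zero fun h0 => ?_
  rw [Real.coe_toNNReal _ hs.le, Measure.hausdorffMeasure_apply] at h0
  -- One `c` pays for the diameters, the other for the thickening; thickened sets have diameter at
  -- most `3 * q n`.
  obtain ⟨c, hc, hcw⟩ : ∃ c : ℝ, 0 < c ∧ (3 / δ) ^ (1 + σ) * (c + c) < w ^ (1 + σ) := by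
    refine ⟨w ^ (1 + σ) / (4 * (3 / δ) ^ (1 + σ)), by positivity, ?_⟩
    have : 0 < (3 / δ) ^ (1 + σ) := by positivity
    have hww : 0 < w ^ (1 + σ) := by positivity
    field_simp
    norm_num
  have h1 : (⨅ (t : ℕ → Set X) (_ : Set.univ ⊆ ⋃ n, t n) (_ : ∀ n, Metric.ediam (t n) ≤ 1),
      ∑' n, ⨆ _ : (t n).Nonempty, Metric.ediam (t n) ^ (1 + σ)) < ENNReal.ofReal c := by
    refine lt_of_le_of_lt ?_ (ENNReal.ofReal_pos.2 hc)
    rw [← h0]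
    exact le_iSup₂ (f := fun (r : ℝ≥0∞) (_ : 0 < r) => ⨅ (t : ℕ → Set X)
      (_ : Set.univ ⊆ ⋃ n, t n) (_ : ∀ n, Metric.ediam (t n) ≤ r),
      ∑' n, ⨆ _ : (t n).Nonempty, Metric.ediam (t n) ^ (1 + σ)) 1 one_pos
  simp only [iInf_lt_iff] at h1
  obtain ⟨t, hcov, hdiam, hsum⟩ := h1
  obtain ⟨e, he, hesum⟩ := ENNReal.exists_pos_sum_of_countable
    (ENNReal.ofReal_pos.2 hc).ne' ℕ
  have hfin : ∀ n, Metric.ediam (t n) ≠ ⊤ := fun n => ne_top_of_le_ne_top ENNReal.one_ne_top (hdiam n)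
  set d : ℕ → ℝ := fun n => Metric.diam (t n) with hd
  have hd0 : ∀ n, 0 ≤ d n := fun n => Metric.diam_nonneg
  -- The second entry keeps the radius positive when the diameter is zero, at a summable cost `e n`.
  set q : ℕ → ℝ := fun n => max (d n) ((e n : ℝ) ^ (1 / (1 + σ))) with hq
  have hq0 : ∀ n, 0 < q n := fun n =>
    lt_max_of_lt_right (Real.rpow_pos_of_pos (by exact_mod_cast he n) _)
  have hqs : ∀ n, q n ^ (1 + σ) ≤ d n ^ (1 + σ) + e n := by
    intro n
    have he' : ((e n : ℝ) ^ (1 / (1 + σ))) ^ (1 + σ) = e n := by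
      rw [← Real.rpow_mul (e n).coe_nonneg, one_div_mul_cancel hs.ne', Real.rpow_one]
    rcases max_choice (d n) ((e n : ℝ) ^ (1 / (1 + σ))) with h | h
    · simp only [hq, h]
      linarith [(e n).coe_nonneg]
    · simp only [hq, h, he']
      linarith [Real.rpow_nonneg (hd0 n) (1 + σ)]
  obtain ⟨T, hT⟩ := (hclosed Q w hQ).isCompact.elim_finite_subcover
    (fun n => Metric.thickening (q n) (t n)) (fun n => Metric.isOpen_thickening) (by
      intro x _
      obtain ⟨n, hn⟩ := Set.mem_iUnion.1 (hcov (Set.mem_univ x))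
      exact Set.mem_iUnion.2 ⟨n, Metric.self_subset_thickening (hq0 n) _ hn⟩)
  have hU : ∀ n, ∀ x ∈ Metric.thickening (q n) (t n), ∀ y ∈ Metric.thickening (q n) (t n),
      dist x y ≤ 3 * q n := by
    intro n x hx y hy
    obtain ⟨x', hx', hxx⟩ := Metric.mem_thickening_iff.1 hx
    obtain ⟨y', hy', hyy⟩ := Metric.mem_thickening_iff.1 hy
    have h2 : dist x' y' ≤ d n := Metric.dist_le_diam_of_mem' (hfin n) hx' hy'
    have h3 : d n ≤ q n := le_max_left _ _
    rw [dist_comm] at hyy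
    linarith [dist_triangle4 x x' y' y]
  obtain ⟨m, hm0, hm⟩ : ∃ m : ℝ, 0 < m ∧ ∀ j ∈ T, m ≤ 3 * q j / δ := by
    rcases T.eq_empty_or_nonempty with rfl | hTne
    · exact ⟨1, one_pos, by simp⟩
    · obtain ⟨j, -, hj⟩ := T.exists_min_image (fun j => 3 * q j / δ) hTne
      exact ⟨3 * q j / δ, by have := hq0 j; positivity, hj⟩
  obtain ⟨n, hn⟩ := exists_pow_lt_of_lt_one (div_pos hm0 hw) hθ1
  have key := rpow_le_sum_of_subset_iUnion hδ hθ hσ hgain hpos hne hsub hθ1.le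
    (fun n => Metric.thickening (q n) (t n)) (fun n => 3 * q n)
    (fun n => by have := hq0 n; positivity) hU m n Q w T hQ hw₀ hT hm
    ((lt_div_iff₀ hw).1 hn).le
  refine absurd key (not_le.2 (lt_of_le_of_lt ?_ hcw))
  have hdT : ∑ j ∈ T, d j ^ (1 + σ) ≤ c := by
    have h2 : ENNReal.ofReal (∑ j ∈ T, d j ^ (1 + σ)) ≤ ENNReal.ofReal c := by
      rw [ENNReal.ofReal_sum_of_nonneg fun j _ => Real.rpow_nonneg (hd0 j) _]
      refine le_trans ?_ ((ENNReal.sum_le_tsum T).trans hsum.le)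
      refine Finset.sum_le_sum fun j _ => ?_
      rw [← ENNReal.ofReal_rpow_of_nonneg (hd0 j) hs.le,
        show ENNReal.ofReal (d j) = Metric.ediam (t j) from ENNReal.ofReal_toReal (hfin j)]
      rcases (t j).eq_empty_or_nonempty with h | h
      · simp [h, hs]
      · exact le_iSup (fun _ : (t j).Nonempty => Metric.ediam (t j) ^ (1 + σ)) h
    exact (ENNReal.ofReal_le_ofReal_iff hc.le).1 h2
  have heT : ∑ j ∈ T, (e j : ℝ) ≤ c := by
    have h2 : ENNReal.ofReal (∑ j ∈ T, (e j : ℝ)) ≤ ENNReal.ofReal c := by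
      rw [ENNReal.ofReal_sum_of_nonneg fun j _ => (e j).coe_nonneg]
      refine le_trans (le_of_eq ?_) ((ENNReal.sum_le_tsum T).trans hesum.le)
      simp
    exact (ENNReal.ofReal_le_ofReal_iff hc.le).1 h2
  calc ∑ j ∈ T, (3 * q j / δ) ^ (1 + σ)
      = (3 / δ) ^ (1 + σ) * ∑ j ∈ T, q j ^ (1 + σ) := by
        rw [Finset.mul_sum]
        refine Finset.sum_congr rfl fun j _ => ?_
        rw [← Real.mul_rpow (by positivity) (hq0 j).le]
        congr 1
        ring
    _ ≤ (3 / δ) ^ (1 + σ) * ∑ j ∈ T, (d j ^ (1 + σ) + e j) := by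
        gcongr with j _
        exact hqs j
    _ ≤ (3 / δ) ^ (1 + σ) * (c + c) := by
        rw [Finset.sum_add_distrib]
        gcongr

end Covering

/-! ### Chains, the chain distance, and the long and short cases. -/

section Chains
variable {X : Type*} [MetricSpace X]

/-- The length of the chain `u 0, …, u n`. -/
noncomputable def chainLength (u : ℕ → X) (n : ℕ) : ℝ :=
  ∑ i ∈ Finset.range n, dist (u i) (u (i + 1))

theorem chainLength_zero (u : ℕ → X) : chainLength u 0 = 0 := by simp [chainLength]

theorem chainLength_succ (u : ℕ → X) (n : ℕ) :
    chainLength u (n + 1) = chainLength u n + dist (u n) (u (n + 1)) :=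
  Finset.sum_range_succ _ _

theorem chainLength_nonneg (u : ℕ → X) (n : ℕ) : 0 ≤ chainLength u n :=
  Finset.sum_nonneg fun _ _ => dist_nonneg

theorem chainLength_congr {u v : ℕ → X} {n : ℕ} (h : ∀ i ≤ n, u i = v i) :
    chainLength u n = chainLength v n :=
  Finset.sum_congr rfl fun i hi => by
    have := Finset.mem_range.1 hi
    rw [h i this.le, h (i + 1) this]

theorem chainLength_add (u : ℕ → X) (m n : ℕ) :
    chainLength u (m + n) = chainLength u m + chainLength (fun i => u (m + i)) n :=
  Finset.sum_range_add _ _ _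

theorem dist_le_chainLength (u : ℕ → X) (n : ℕ) : dist (u 0) (u n) ≤ chainLength u n :=
  dist_le_range_sum_dist u n

theorem dist_le_chainLength_sub (u : ℕ → X) {i j : ℕ} (hij : i ≤ j) :
    dist (u i) (u j) ≤ chainLength u j - chainLength u i := by
  obtain ⟨k, rfl⟩ := Nat.exists_eq_add_of_le hij
  have := dist_le_chainLength (fun l => u (i + l)) k
  rw [chainLength_add]
  simpa using this

/-- `u 0, …, u n` is a chain in `Q` with steps at most `t` starting in `S`. -/
structure IsStepChain (Q S : Set X) (t : ℝ) (u : ℕ → X) (n : ℕ) : Prop where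
  start : u 0 ∈ S
  mem : ∀ i ≤ n, u i ∈ Q
  step : ∀ i < n, dist (u i) (u (i + 1)) ≤ t

/-- The infimal length of the chains in `Q` with steps at most `t` from `S` to `x`, or `C` if this is
smaller. -/
noncomputable def chainDist (Q S : Set X) (t C : ℝ) (x : X) : ℝ :=
  sInf (insert C {l | ∃ u n, IsStepChain Q S t u n ∧ u n = x ∧ chainLength u n = l})

variable {Q S : Set X} {t C : ℝ}

theorem bddBelow_chainLengths (Q S : Set X) (t C : ℝ) (x : X) :
    BddBelow (insert C {l | ∃ u n, IsStepChain Q S t u n ∧ u n = x ∧ chainLength u n = l}) := by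
  refine BddBelow.insert C ⟨0, ?_⟩
  rintro _ ⟨u, n, -, -, rfl⟩
  exact chainLength_nonneg u n

theorem chainDist_le (x : X) : chainDist Q S t C x ≤ C :=
  csInf_le (bddBelow_chainLengths Q S t C x) (Set.mem_insert _ _)

theorem chainDist_le_chainLength {u : ℕ → X} {n : ℕ} (hu : IsStepChain Q S t u n) :
    chainDist Q S t C (u n) ≤ chainLength u n :=
  csInf_le (bddBelow_chainLengths Q S t C _) (Set.mem_insert_of_mem _ ⟨u, n, hu, rfl, rfl⟩)

theorem le_chainDist {x : X} {c : ℝ} (hC : c ≤ C)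
    (h : ∀ u n, IsStepChain Q S t u n → u n = x → c ≤ chainLength u n) :
    c ≤ chainDist Q S t C x := by
  refine le_csInf (Set.insert_nonempty _ _) ?_
  rintro _ (rfl | ⟨u, n, hu, hx, rfl⟩)
  exacts [hC, h u n hu hx]

theorem chainDist_eq_zero {x : X} (hC : 0 ≤ C) (hx : x ∈ S) (hxQ : x ∈ Q) :
    chainDist Q S t C x = 0 := by
  refine le_antisymm ?_ (le_chainDist hC fun u n _ _ => chainLength_nonneg u n)
  have : IsStepChain Q S t (fun _ => x) 0 := ⟨hx, fun _ _ => hxQ, by simp⟩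
  simpa [chainLength_zero] using chainDist_le_chainLength (C := C) this

theorem chainDist_le_add {x y : X} (hy : y ∈ Q) (hxy : dist x y ≤ t) :
    chainDist Q S t C y ≤ chainDist Q S t C x + dist x y := by
  rw [← sub_le_iff_le_add]
  have hxy0 : 0 ≤ dist x y := dist_nonneg
  have hyC : chainDist Q S t C y ≤ C := chainDist_le y
  refine le_chainDist (by linarith) fun u n hu hux => ?_
  set v : ℕ → X := fun i => if i ≤ n then u i else y with hv
  have hvu : ∀ i ≤ n, v i = u i := fun i hi => if_pos hi
  have hvn : v (n + 1) = y := if_neg (by omega)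
  have hch : IsStepChain Q S t v (n + 1) := by
    refine ⟨by rw [hvu 0 (Nat.zero_le _)]; exact hu.start, fun i hi => ?_, fun i hi => ?_⟩
    · rcases Nat.le_succ_iff.1 hi with h | rfl
      · rw [hvu i h]
        exact hu.mem i h
      · rwa [hvn]
    · rcases Nat.lt_succ_iff_lt_or_eq.1 hi with h | rfl
      · rw [hvu i h.le, hvu (i + 1) h]
        exact hu.step i h
      · rwa [hvu i le_rfl, hvn, hux]
  have := chainDist_le_chainLength (C := C) hch
  rw [hvn, chainLength_succ, hvn, hvu n le_rfl, hux, chainLength_congr hvu] at this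
  linarith

/-- If all chains from the bottom to the top of a crossing are long, the slabs of the chain distance
form a subdivision of large total width. -/
theorem IsCrossing.hasSubdivision_of_long {f : X → ℝ} {a b δ θ ε g : ℝ} {K : ℕ}
    (hQ : IsCrossing Q f a b) (hg : 0 < g) (hgt : g < t)
    (hlong : ∀ u n, IsStepChain Q {x | f x ≤ a + t} t u n → b - t ≤ f (u n) →
      K * t ≤ chainLength u n)
    (hδg : δ * (b - a) ≤ g) (hδt : δ * (b - a) ≤ t - g) (hθ : t - g ≤ θ * (b - a))
    (hε : (1 + ε) * (b - a) ≤ K * (t - g)) :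
    HasSubdivision IsPiece δ θ ε Q (b - a) := by
  have ht : 0 < t := hg.trans hgt
  -- The margins of height `t` at both levels, where `h` is `0` or `K * t`, keep the interiors of
  -- the slabs of `h` at depth more than their width inside `Q`.
  set h : X → ℝ := chainDist Q {x | f x ≤ a + t} t (K * t) with hh
  have hC : (0 : ℝ) ≤ K * t := by positivity
  have h0 : ∀ x ∈ Q, f x ≤ a + t → h x = 0 := fun x hx hfx => chainDist_eq_zero hC hfx hx
  have h1 : ∀ x ∈ Q, b - t ≤ f x → h x = K * t := fun x hx hfx =>
    le_antisymm (chainDist_le x) (le_chainDist le_rfl fun u n hu hux =>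
      hlong u n hu (by rwa [hux]))
  have hlip : ∀ x ∈ Q, ∀ y ∈ Q, dist x y ≤ t → |h x - h y| ≤ dist x y := by
    intro x hx y hy hxy
    have e1 : h y ≤ h x + dist x y := chainDist_le_add hy hxy
    have e2 : h x ≤ h y + dist y x := chainDist_le_add hx (by rwa [dist_comm])
    rw [dist_comm y x] at e2
    rw [abs_le]
    constructor <;> linarith
  have hkK : ∀ k : Fin K, ((k : ℕ) + 1 : ℝ) * t ≤ K * t := fun k => by
    have : ((k : ℕ) + 1 : ℝ) ≤ K := by exact_mod_cast k.2
    gcongr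
  have hk0 : ∀ k : Fin K, 0 ≤ ((k : ℕ) : ℝ) * t := fun k => by positivity
  -- Points of different slabs are more than `t` apart or, by the Lipschitz bound at scale `t`, at
  -- least the gap `g` apart.
  refine ⟨Fin K, inferInstance,
    fun k => Q ∩ h ⁻¹' Set.Icc ((k : ℕ) * t + g) (((k : ℕ) + 1) * t), fun _ => t - g,
    fun k => ⟨h, (k : ℕ) * t + g, ((k : ℕ) + 1) * t, ?_, by ring⟩, fun k => Set.inter_subset_left,
    fun _ => hδt, fun _ => hθ, ?_,
    by rwa [Finset.sum_const, Finset.card_univ, Fintype.card_fin, nsmul_eq_mul]⟩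
  · have hk := hkK k
    have hk' := hk0 k
    refine hQ.slab (by linarith) (fun x hx y hy hxy => hlip x hx y hy (by linarith)) ?_ ?_ ?_
    · intro x hx hfx
      rw [h0 x hx (by linarith)]
      linarith
    · intro x hx hfx
      rw [h1 x hx (by linarith)]
      exact hk
    · intro x hx d hd1 hd2
      have hI := hQ.mem_Icc x hx
      rcases lt_or_ge d 0 with hd | hd
      · exact ⟨by linarith [hI.1], by linarith [hI.2]⟩
      constructor
      · by_contra! hcon
        have := h0 x hx (by linarith)
        linarith
      · by_contra! hcon
        have := h1 x hx (by linarith)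
        linarith
  · have key : ∀ i j : Fin K, i < j →
        ∀ x ∈ Q ∩ h ⁻¹' Set.Icc ((i : ℕ) * t + g) (((i : ℕ) + 1) * t),
        ∀ y ∈ Q ∩ h ⁻¹' Set.Icc ((j : ℕ) * t + g) (((j : ℕ) + 1) * t),
        δ * (b - a) ≤ dist x y := by
      rintro i j hij x ⟨hx, hx1⟩ y ⟨hy, hy1⟩
      have hij' : ((i : ℕ) + 1 : ℝ) * t ≤ (j : ℕ) * t := by
        have : ((i : ℕ) + 1 : ℝ) ≤ (j : ℕ) := by exact_mod_cast hij
        gcongr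
      rcases le_total (dist x y) t with hd | hd
      · have := (abs_le.1 (hlip x hx y hy hd)).1
        linarith [hx1.2, hy1.1]
      · linarith
    intro i j hij x hx y hy
    rcases lt_or_gt_of_ne hij with h | h
    · exact key i j h x hx y hy
    · rw [dist_comm]
      exact key j i h y hy x hx

/-- A discrete intermediate value theorem. -/
theorem exists_mem_Icc_of_step {g : ℕ → ℝ} {n : ℕ} {v t : ℝ} (ht : 0 ≤ t) (h0 : g 0 ≤ v)
    (hn : v ≤ g n) (hstep : ∀ i < n, g (i + 1) ≤ g i + t) : ∃ i ≤ n, g i ∈ Set.Icc v (v + t) := by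
  induction n with
  | zero => exact ⟨0, le_rfl, hn, by linarith⟩
  | succ n ih =>
    rcases le_total v (g n) with h | h
    · obtain ⟨i, hi, hgi⟩ := ih h fun i hi => hstep i (by omega)
      exact ⟨i, by omega, hgi⟩
    · exact ⟨n + 1, le_rfl, hn, by linarith [hstep n (by omega)]⟩

/-- Every almost geodesic chain in a ball of radius less than `r₀` misses a point of this ball by a
definite amount. -/
def IsWiggly (X : Type*) [MetricSpace X] (β r₀ : ℝ) : Prop :=
  ∀ (x : X) (r : ℝ), 0 < r → r < r₀ → ∀ (u : ℕ → X) (n : ℕ), (∀ i ≤ n, dist (u i) x < r) →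
    ∀ d η κ : ℝ, 0 < d → 0 ≤ η → 0 ≤ κ → d ≤ dist (u 0) (u n) →
      chainLength u n ≤ dist (u 0) (u n) + η → η + κ ≤ β * d →
      ∃ z : X, dist z x < r ∧ ∀ i ≤ n, κ < dist z (u i)

/-- A short chain across a crossing leads to two distant points at nearly the same level. -/
theorem IsCrossing.exists_two_points {f : X → ℝ} {a b β r₀ η : ℝ} (hQ : IsCrossing Q f a b)
    (hX : IsWiggly X β r₀) (hβ : 0 < β) (hr₀ : (b - a) / 8 < r₀) (ht : 0 < t) {u : ℕ → X} {n : ℕ}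
    (hu : IsStepChain Q {x | f x ≤ a + t} t u n) (hun : b - t ≤ f (u n)) (hη0 : 0 ≤ η)
    (hη : chainLength u n ≤ b - a - 2 * t + η) (hsmall : 4 * t + 2 * η ≤ (b - a) / 8)
    (hηβ : η ≤ β * (b - a) / 16) :
    ∃ z ∈ Q, ∃ y ∈ Q, |f y - f z| ≤ 2 * t + η ∧ β * (b - a) / 16 ≤ dist y z ∧
      a + (b - a) / 8 ≤ f z ∧ f z ≤ b - (b - a) / 8 := by
  have hw : 0 < b - a := sub_pos.2 hQ.lt
  obtain ⟨r, hr⟩ : ∃ r, r = (b - a) / 8 := ⟨_, rfl⟩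
  set τ := chainLength u with hτ
  have hdist : ∀ i j, i ≤ j → dist (u i) (u j) ≤ τ j - τ i := fun i j hij =>
    dist_le_chainLength_sub u hij
  have hf : ∀ i ≤ n, ∀ j ≤ n, |f (u j) - f (u i)| ≤ dist (u i) (u j) := fun i hi j hj => by
    rw [dist_comm]
    exact hQ.abs_sub_le _ (hu.mem j hj) _ (hu.mem i hi)
  have hfτ : ∀ i j, i ≤ j → j ≤ n → f (u j) - f (u i) ≤ τ j - τ i := fun i j hij hj =>
    ((le_abs_self _).trans (hf i (hij.trans hj) j hj)).trans (hdist i j hij)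
  have hf0 : f (u 0) ≤ a + t := hu.start
  have hτ0 : τ 0 = 0 := chainLength_zero u
  -- The excess of length over gain in level is nonnegative on every subchain and at most `η` in
  -- total.
  have hexc : ∀ i j, i ≤ j → j ≤ n → τ j - τ i ≤ f (u j) - f (u i) + η := fun i j hij hj => by
    linarith [hfτ 0 i (Nat.zero_le _) (hij.trans hj), hfτ j n hj le_rfl]
  have hτs : ∀ i < n, τ (i + 1) ≤ τ i + t := fun i hi => by
    rw [hτ, chainLength_succ]
    linarith [hu.step i hi]
  have hfs : ∀ i < n, f (u (i + 1)) ≤ f (u i) + t := fun i hi => by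
    linarith [(abs_le.1 (hf i hi.le (i + 1) hi)).2, hu.step i hi]
  obtain ⟨m, hm, hm1, hm2⟩ := exists_mem_Icc_of_step (g := fun i => f (u i)) (v := (a + b) / 2)
    ht.le (by linarith) (by linarith) hfs
  -- The ends of the subchain are chosen by length, just under `r` on either side of `m`: it stays
  -- in the ball around `u m`, and its ends are at least `2 * r - 4 * t - η ≥ r` apart.
  obtain ⟨i₀, hi₀, hi1, hi2⟩ := exists_mem_Icc_of_step (g := τ) (n := m) (v := τ m - r + t)
    ht.le (by linarith [hfτ 0 m (Nat.zero_le _) hm]) (by linarith)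
    fun i hi => hτs i (hi.trans_le hm)
  obtain ⟨k, hk, hk1, hk2⟩ := exists_mem_Icc_of_step (g := fun i => τ (m + i)) (n := n - m)
    (v := τ m + r - 2 * t) ht.le (by rw [add_zero]; linarith)
    (by rw [Nat.add_sub_cancel' hm]; linarith [hfτ m n hm le_rfl])
    fun i hi => hτs (m + i) (by omega)
  obtain ⟨l, rfl⟩ := Nat.exists_eq_add_of_le hi₀
  set m := i₀ + l with hmdef
  have e1 := hexc i₀ m hi₀ hm
  have e2 := hexc m (m + k) (Nat.le_add_right _ _) (by omega)
  have hidx : i₀ + (l + k) = m + k := by omega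
  have hlen : chainLength (fun i => u (i₀ + i)) (l + k) = τ (m + k) - τ i₀ := by
    rw [← hidx, hτ]
    linarith [chainLength_add u i₀ (l + k)]
  have hend : f (u (m + k)) - f (u i₀) ≤ dist (u i₀) (u (m + k)) :=
    (le_abs_self _).trans (hf i₀ (by omega) (m + k) (by omega))
  obtain ⟨z, hz, hfar⟩ := hX (u m) r (by linarith) (by linarith) (fun i => u (i₀ + i)) (l + k)
    (by
      intro i hi
      rcases le_total (i₀ + i) m with h | h
      · have h2 := chainLength_add u i₀ i
        have h3 := chainLength_nonneg (fun j => u (i₀ + j)) i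
        linarith [hdist (i₀ + i) m h]
      · obtain ⟨q, hq⟩ := Nat.exists_eq_add_of_le (show i₀ + i ≤ m + k by omega)
        have h2 := chainLength_add u (i₀ + i) q
        have h3 := chainLength_nonneg (fun j => u (i₀ + i + j)) q
        rw [← hq] at h2
        have := hdist m (i₀ + i) h
        rw [dist_comm] at this
        linarith)
    r η (β * r / 2) (by linarith) hη0 (by rw [hr]; positivity)
    (by rw [add_zero, hidx]; linarith)
    (by rw [hlen, add_zero, hidx]; linarith [hexc i₀ (m + k) (by omega) (by omega)])
    (by rw [hr]; linarith)
  have hzQ : z ∈ Q := by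
    refine hQ.interior (u m) (hu.mem m hm) z ?_ ?_ <;> rw [dist_comm] <;> linarith
  have hfz := abs_le.1 (hQ.abs_sub_le z hzQ (u m) (hu.mem m hm))
  -- The levels of the subchain reach within `2 * t + η` of `f (u m) - r` and `f (u m) + r`, and `f
  -- z` lies between these.
  have hy : ∃ i ≤ l + k, |f (u (i₀ + i)) - f z| ≤ 2 * t + η := by
    by_cases c1 : f z ≤ f (u i₀)
    · refine ⟨0, Nat.zero_le _, ?_⟩
      rw [add_zero, abs_le]
      constructor <;> linarith
    by_cases c2 : f (u (m + k)) ≤ f z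
    · refine ⟨l + k, le_rfl, ?_⟩
      rw [hidx, abs_le]
      constructor <;> linarith
    obtain ⟨i, hi, h1, h2⟩ := exists_mem_Icc_of_step (g := fun i => f (u (i₀ + i))) (n := l + k)
      (v := f z) ht.le (by rw [add_zero]; linarith) (by rw [hidx]; linarith)
      fun i hi => hfs (i₀ + i) (by omega)
    refine ⟨i, hi, ?_⟩
    rw [abs_le]
    constructor <;> linarith
  obtain ⟨i, hi, hiz⟩ := hy
  refine ⟨z, hzQ, u (i₀ + i), hu.mem _ (by omega), hiz, ?_, by linarith, by linarith⟩
  have := hfar i hi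
  rw [dist_comm, hr] at this
  linarith

end Chains

/-! ### Every small piece of a wiggly space subdivides. -/

section Subdivision
variable {X : Type*} [MetricSpace X]

/-- The parts of a crossing below and above a middle slab, together with separated pieces in this
slab. -/
theorem IsCrossing.hasSubdivision_of_middle {Q : Set X} {f : X → ℝ} {a b δ ε m c g : ℝ}
    (hQ : IsCrossing Q f a b) (hδ : 0 < δ) (hc : 0 < c) (hg : 0 < g) (hδg : δ * (b - a) ≤ g)
    (ham : a + (b - a) / 8 ≤ m) (hmb : m ≤ b - (b - a) / 8)
    (hcg : c + g + δ * (b - a) < (b - a) / 8)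
    {I : Type} [Fintype I] {P : I → Set X} {w : I → ℝ} (hP : ∀ i, IsPiece (P i) (w i))
    (hPQ : ∀ i, P i ⊆ Q ∩ f ⁻¹' Set.Icc (m - c) (m + c))
    (hw : ∀ i, δ * (b - a) ≤ w i) (hw' : ∀ i, w i ≤ 7 / 8 * (b - a))
    (hsep : ∀ i j, i ≠ j → ∀ x ∈ P i, ∀ y ∈ P j, δ * (b - a) ≤ dist x y)
    (hsum : ε * (b - a) + 2 * c + 2 * g ≤ ∑ i, w i) :
    HasSubdivision IsPiece δ (7 / 8) ε Q (b - a) := by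
  have hδ' : 0 < δ * (b - a) := mul_pos hδ (sub_pos.2 hQ.lt)
  have hfar : ∀ x ∈ Q, ∀ y ∈ Q, δ * (b - a) ≤ f y - f x → δ * (b - a) ≤ dist x y := by
    intro x hx y hy h
    have := abs_le.1 (hQ.abs_sub_le x hx y hy)
    linarith [this.1]
  have hfar' : ∀ x ∈ Q, ∀ y ∈ Q, δ * (b - a) ≤ f y - f x → δ * (b - a) ≤ dist y x := by
    intro x hx y hy h
    rw [dist_comm]
    exact hfar x hx y hy h
  -- The two outer parts lose `2 * c + 2 * g` of the width, which the middle pieces must more than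
  -- replace.
  set L : Set X := Q ∩ f ⁻¹' Set.Icc a (m - c - g) with hL
  set H : Set X := Q ∩ f ⁻¹' Set.Icc (m + c + g) b with hH
  have pL : IsPiece L (m - c - g - a) :=
    ⟨f, a, m - c - g, hQ.restrict le_rfl (by linarith) (by linarith), rfl⟩
  have pH : IsPiece H (b - (m + c + g)) :=
    ⟨f, m + c + g, b, hQ.restrict (by linarith) (by linarith) le_rfl, rfl⟩
  have sLH : ∀ x ∈ L, ∀ y ∈ H, δ * (b - a) ≤ f y - f x := fun x hx y hy => by
    linarith [hx.2.2, hy.2.1]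
  have sLP : ∀ i, ∀ x ∈ L, ∀ y ∈ P i, δ * (b - a) ≤ f y - f x := fun i x hx y hy => by
    linarith [hx.2.2, (hPQ i hy).2.1]
  have sPH : ∀ i, ∀ x ∈ P i, ∀ y ∈ H, δ * (b - a) ≤ f y - f x := fun i x hx y hy => by
    linarith [hy.2.1, (hPQ i hx).2.2]
  refine ⟨Option (Option I), inferInstance,
    fun o => o.elim L fun o' => o'.elim H P,
    fun o => o.elim (m - c - g - a) fun o' => o'.elim (b - (m + c + g)) w, ?_, ?_, ?_, ?_, ?_, ?_⟩
  · rintro (_ | _ | i)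
    exacts [pL, pH, hP i]
  · rintro (_ | _ | i)
    exacts [Set.inter_subset_left, Set.inter_subset_left, (hPQ i).trans Set.inter_subset_left]
  · rintro (_ | _ | i) <;> simp only [Option.elim]
    exacts [by linarith, by linarith, hw i]
  · rintro (_ | _ | i) <;> simp only [Option.elim]
    exacts [by linarith, by linarith, hw' i]
  · rintro (_ | _ | i) (_ | _ | j) hij x hx y hy
    · exact absurd rfl hij
    · exact hfar x hx.1 y hy.1 (sLH x hx y hy)
    · exact hfar x hx.1 y (hPQ j hy).1 (sLP j x hx y hy)
    · exact hfar' y hy.1 x hx.1 (sLH y hy x hx)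
    · exact absurd rfl hij
    · exact hfar' y (hPQ j hy).1 x hx.1 (sPH j y hy x hx)
    · exact hfar' y hy.1 x (hPQ i hx).1 (sLP i y hy x hx)
    · exact hfar x (hPQ i hx).1 y hy.1 (sPH i x hx y hy)
    · exact hsep i j (fun h => hij (by rw [h])) x hx y hy
  · rw [Fintype.sum_option, Fintype.sum_option]
    simp only [Option.elim]
    linarith

/-- Two distant points at nearly the same level of a crossing give a subdivision. -/
theorem IsCrossing.hasSubdivision_of_two_points [PreconnectedSpace X] {Q : Set X} {f : X → ℝ}
    {a b δ ε p : ℝ} (hQ : IsCrossing Q f a b) (hδ : 0 < δ) {y z : X} (hz : z ∈ Q) (hy : y ∈ Q) (hp : 0 < p)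
    (hyz : |f y - f z| ≤ p / 4) (hd : 32 * p ≤ dist y z) (haz : a + (b - a) / 8 ≤ f z)
    (hzb : f z ≤ b - (b - a) / 8) (hpw : 64 * p ≤ b - a) (hδp : δ * (b - a) ≤ p / 8)
    (hε : ε * (b - a) ≤ p / 4) :
    HasSubdivision IsPiece δ (7 / 8) ε Q (b - a) := by
  obtain ⟨m, hm⟩ : ∃ m, m = f z := ⟨_, rfl⟩
  have ball_sub : ∀ u ∈ Q, ∀ s c, s ≤ p → |f u - m| + s ≤ c → c < 3 * p →
      Metric.closedBall u s ⊆ Q ∩ f ⁻¹' Set.Icc (m - c) (m + c) := by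
    intro u hu s c hs hc hc3 x hx
    have hx' : dist u x ≤ s := by
      rw [dist_comm]
      exact hx
    have hu' := abs_le.1 (show |f u - m| ≤ c - s by linarith)
    have hxQ : x ∈ Q := hQ.interior u hu x (by linarith) (by linarith)
    have := abs_le.1 (hQ.abs_sub_le u hu x hxQ)
    exact ⟨hxQ, by linarith, by linarith⟩
  have ball_piece : ∀ (u : X) (s : ℝ), 0 < s → s ≤ p → IsPiece (Metric.closedBall u s) s := by
    intro u s hs hsp
    have : ∃ w : X, s < dist w u := by
      by_contra! hcon
      have h1 := hcon y
      have h2 := hcon z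
      linarith [dist_triangle_right y z u]
    obtain ⟨w, hw⟩ := this
    exact ⟨_, 0, s, isCrossing_closedBall hs hw, sub_zero s⟩
  have hM := hQ.restrict (a' := m - p) (b' := m + p) (by linarith) (by linarith) (by linarith)
  set M := Q ∩ f ⁻¹' Set.Icc (m - p) (m + p) with hMdef
  -- If `M` meets all eight shells around `z`, eight balls of radius `p` replace the loss `4 * p + 2
  -- * p`.
  by_cases hmany : ∀ j : Fin 8, ∃ u ∈ M, dist u z ∈ Set.Icc (4 * (j : ℕ) * p) (4 * (j : ℕ) * p + p)
  · choose u hu hu1 using hmany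
    refine hQ.hasSubdivision_of_middle hδ (m := m) (c := 2 * p) (g := p)
      (P := fun j => Metric.closedBall (u j) p) (w := fun _ => p) (by linarith) hp (by linarith)
      (by linarith) (by linarith) (by linarith) (fun j => ball_piece _ _ hp le_rfl) ?_
      (fun _ => by linarith) (fun _ => by linarith) ?_ ?_
    · intro j
      refine ball_sub _ (hu j).1 p _ le_rfl ?_ (by linarith)
      have h1 := (hu j).2
      have : |f (u j) - m| ≤ p := by
        rw [abs_le]
        constructor <;> linarith [h1.1, h1.2]
      linarith
    · have key : ∀ i j : Fin 8, i < j → ∀ x ∈ Metric.closedBall (u i) p,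
          ∀ x' ∈ Metric.closedBall (u j) p, δ * (b - a) ≤ dist x x' := by
        intro i j hij x hx x' hx'
        have hij' : ((i : ℕ) + 1 : ℝ) * p ≤ (j : ℕ) * p := by
          have : ((i : ℕ) + 1 : ℝ) ≤ (j : ℕ) := by exact_mod_cast hij
          gcongr
        rw [Metric.mem_closedBall] at hx
        rw [Metric.mem_closedBall, dist_comm] at hx'
        have h3 := dist_triangle_left (u j) z (u i)
        have h4 := dist_triangle4 (u j) x' x (u i)
        have h5 := dist_triangle (u j) (u i) z
        rw [dist_comm (u j) x', dist_comm x' x] at h4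
        rw [dist_comm x' (u j)] at h4
        linarith [(hu1 i).2, (hu1 j).1, hx, hx']
      intro i j hij x hx x' hx'
      rcases lt_or_gt_of_ne hij with h | h
      · exact key i j h x hx x' hx'
      · rw [dist_comm]
        exact key j i h x' hx' x hx
    · rw [Finset.sum_const, Finset.card_univ, Fintype.card_fin, nsmul_eq_mul]
      push_cast
      linarith
  · push Not at hmany
    obtain ⟨j, hj⟩ := hmany
    -- An empty shell splits `M` into parts at distance `p`, half its width, as `IsCrossing.split`
    -- needs; `y` is outside since `v + p ≤ 29 * p`.
    obtain ⟨v, hv⟩ : ∃ v : ℝ, v = 4 * (j : ℕ) * p := ⟨_, rfl⟩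
    have hv0 : 0 ≤ v := by rw [hv]; positivity
    have hv1 : v ≤ 28 * p := by
      have : ((j : ℕ) : ℝ) ≤ 7 := by exact_mod_cast Nat.le_of_lt_succ j.2
      rw [hv]
      nlinarith
    have hcont : Continuous fun x : X => dist x z := by fun_prop
    set A := M ∩ {x | dist x z ≤ v} with hA
    set B := M ∩ {x | v + p ≤ dist x z} with hB
    have hU : A ∪ B = M := by
      rw [hA, hB, ← Set.inter_union_distrib_left, Set.inter_eq_left]
      intro x hx
      by_contra hcon
      rw [Set.mem_union, Set.mem_ofPred_eq, Set.mem_ofPred_eq, not_or, not_le, not_le] at hcon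
      exact hj x hx ⟨by linarith, by linarith⟩
    have hAB : ∀ x ∈ A, ∀ x' ∈ B, p ≤ dist x x' := by
      rintro x ⟨-, hx⟩ x' ⟨-, hx'⟩
      rw [Set.mem_ofPred_eq] at hx hx'
      have := dist_triangle_left x' z x
      linarith
    have hzA : z ∈ A := ⟨⟨hz, by rw [Set.mem_preimage, ← hm]; constructor <;> linarith⟩, by simpa⟩
    have hyB : y ∈ B := by
      have := abs_le.1 hyz
      exact ⟨⟨hy, by linarith, by linarith⟩, by rw [Set.mem_ofPred_eq]; linarith⟩
    -- `D` is the part that crosses and `q` the one of `y`, `z` in the other part. Widths `2 * p`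
    -- and `p / 2` exceed the loss `2 * p + p / 4` by `p / 4`.
    have main : ∀ (D : Set X) (q : X), IsCrossing D f (m - p) (m + p) → D ⊆ M → q ∈ Q →
        |f q - m| ≤ p / 4 → (∀ x ∈ D, p ≤ dist x q) →
        HasSubdivision IsPiece δ (7 / 8) ε Q (b - a) := by
      intro D q hD hDM hq hqm hDq
      have hsep : ∀ x ∈ D, ∀ x' ∈ Metric.closedBall q (p / 2), δ * (b - a) ≤ dist x x' := by
        intro x hx x' hx'
        rw [Metric.mem_closedBall] at hx'
        linarith [hDq x hx, dist_triangle x x' q]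
      refine hQ.hasSubdivision_of_middle hδ (m := m) (c := p) (g := p / 8) (I := Bool)
        (P := fun i => cond i D (Metric.closedBall q (p / 2)))
        (w := fun i => cond i (2 * p) (p / 2)) hp (by linarith) hδp (by linarith) (by linarith)
        (by linarith) ?_ ?_ ?_ ?_ ?_ ?_
      · rintro (_ | _)
        · exact ball_piece q _ (by linarith) (by linarith)
        · exact ⟨f, m - p, m + p, hD, by simp only [cond_true]; ring⟩
      · rintro (_ | _)
        · exact ball_sub q hq _ _ (by linarith) (by linarith) (by linarith)
        · exact hDM
      · rintro (_ | _) <;> simp only [cond_true, cond_false] <;> linarith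
      · rintro (_ | _) <;> simp only [cond_true, cond_false] <;> linarith
      · rintro (_ | _) (_ | _) hij x hx x' hx'
        · exact absurd rfl hij
        · rw [dist_comm]
          exact hsep x' hx' x hx
        · exact hsep x hx x' hx'
        · exact absurd rfl hij
      · rw [Fintype.sum_bool]
        simp only [cond_true, cond_false]
        linarith
    have hclA : IsClosed A := hM.isClosed.inter (isClosed_le hcont continuous_const)
    have hclB : IsClosed B := hM.isClosed.inter (isClosed_le continuous_const hcont)
    rcases hM.split hclA hclB hU (fun x hx x' hx' => by linarith [hAB x hx x' hx']) with h | h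
    · exact main A y h Set.inter_subset_left hy (by rwa [hm]) fun x hx => hAB x hx y hyB
    · refine main B z h Set.inter_subset_left hz (by rw [hm, sub_self, abs_zero]; linarith)
        fun x hx => ?_
      rw [dist_comm]
      exact hAB z hzA x hx

theorem hasSubdivision_of_isWiggly [PreconnectedSpace X] {β r₀ : ℝ} (hX : IsWiggly X β r₀)
    (hβ : 0 < β) (hβ2 : β < 2) {Q : Set X} {w : ℝ} (hQ : IsPiece Q w) (hw : w / 8 < r₀) :
    HasSubdivision IsPiece (β ^ 2 / 2 ^ 31) (7 / 8) (β / 2 ^ 14) Q w := by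
  obtain ⟨f, a, b, hQ, rfl⟩ := hQ
  obtain ⟨w, hwdef⟩ : ∃ w, w = b - a := ⟨_, rfl⟩
  have hw0 : 0 < w := hwdef ▸ sub_pos.2 hQ.lt
  have hβw : 0 < β * w := mul_pos hβ hw0
  have hβw2 : β * w ≤ 2 * w := by gcongr
  have hββw : β ^ 2 * w ≤ 2 * (β * w) := by nlinarith
  -- This makes `t` lie between `β w / 2 ^ 16` and `β w / 2 ^ 14`, so the gap `β t / 2 ^ 15` used
  -- for long chains is at least `δ w`.
  set K : ℕ := ⌈2 ^ 15 / β⌉₊ with hK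
  have hK1 : 2 ^ 15 ≤ β * K := by
    have := Nat.le_ceil (2 ^ 15 / β)
    rwa [div_le_iff₀ hβ, mul_comm, ← hK] at this
  have hK2 : β * K ≤ 2 ^ 16 := by
    have := (Nat.ceil_lt_add_one (show 0 ≤ 2 ^ 15 / β by positivity)).le
    have h2 : β * K ≤ β * (2 ^ 15 / β + 1) := by gcongr
    rw [mul_add, mul_div_cancel₀ _ hβ.ne'] at h2
    linarith
  have hK0 : (0 : ℝ) < K := by
    by_contra! h
    nlinarith
  obtain ⟨C, hC⟩ : ∃ C, C = (1 + β / 2 ^ 13) * w := ⟨_, rfl⟩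
  obtain ⟨t, ht⟩ : ∃ t, t = C / K := ⟨_, rfl⟩
  have hKt : K * t = C := by rw [ht, mul_div_cancel₀ _ hK0.ne']
  have hCw : C = w + β * w / 2 ^ 13 := by rw [hC]; ring
  have hC0 : 0 < C := by rw [hCw]; positivity
  have ht0 : 0 < t := by rw [ht]; positivity
  have ht1 : 2 ^ 15 * t ≤ β * C := by
    rw [← hKt]
    nlinarith
  have ht2 : β * C ≤ 2 ^ 16 * t := by
    rw [← hKt]
    nlinarith
  have hβC : β * C = β * w + β ^ 2 * w / 2 ^ 13 := by rw [hCw]; ring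
  have ht3 : 2 ^ 14 * t ≤ β * w := by
    rw [hβC] at ht1
    linarith
  have ht4 : β * w ≤ 2 ^ 16 * t := by
    have : 0 ≤ β ^ 2 * w / 2 ^ 13 := by positivity
    linarith
  have hβt : β * t ≤ 2 * t := by gcongr
  have hβt0 : 0 < β * t := mul_pos hβ ht0
  by_cases hlong : ∀ u n, IsStepChain Q {x | f x ≤ a + t} t u n → b - t ≤ f (u n) →
      K * t ≤ chainLength u n
  · refine hQ.hasSubdivision_of_long (g := β * t / 2 ^ 15) (by positivity) (by linarith) hlong
      ?_ ?_ ?_ ?_ <;> rw [← hwdef]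
    · nlinarith
    · nlinarith
    · linarith
    · have h1 : (K : ℝ) * (t - β * t / 2 ^ 15) = C - β * C / 2 ^ 15 := by
        rw [← hKt]
        ring
      rw [h1, hβC, hCw]
      linarith
  · push Not at hlong
    obtain ⟨u, n, hu, hun, hlen⟩ := hlong
    rw [hKt] at hlen
    obtain ⟨z, hz, y, hy, h1, h2, h3, h4⟩ := hQ.exists_two_points
      (η := β * w / 2 ^ 13 + 2 * t) hX hβ hw ht0 hu hun (by positivity)
      (by rw [← hwdef]; linarith) (by rw [← hwdef]; linarith) (by rw [← hwdef]; linarith)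
    rw [← hwdef] at h2
    refine hQ.hasSubdivision_of_two_points (p := β * w / 512) (by positivity) hz hy (by positivity)
      (h1.trans (by linarith)) (by linarith) h3 h4 ?_ ?_ ?_ <;> rw [← hwdef]
    · linarith
    · linarith
    · linarith

/-- The crude bound `log (1 / δ) ≤ 64 / β` makes the exponent quadratic: `δ ^ σ` then loses at most
`β / 2 ^ 15`, half the gain. -/
theorem one_le_gain {β : ℝ} (hβ : 0 < β) (hβ2 : β < 2) :
    1 ≤ (1 + β / 2 ^ 14) * (β ^ 2 / 2 ^ 31) ^ ((1 / 2 ^ 21 : ℝ) * β ^ 2) := by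
  have hδ : 0 < β ^ 2 / 2 ^ 31 := by positivity
  have hlog : -64 / β ≤ Real.log (β ^ 2 / 2 ^ 31) := by
    rw [Real.log_div (by positivity) (by positivity), Real.log_pow, Real.log_pow]
    have h1 := Real.one_sub_inv_le_log_of_pos hβ
    have h2 : Real.log 2 ≤ 1 := by linarith [Real.log_two_lt_d9]
    have h3 : 1 ≤ 2 / β := (one_le_div hβ).2 hβ2.le
    have h4 : -64 / β = -2 * β⁻¹ - 31 * (2 / β) := by ring
    push_cast
    linarith
  have h1 : 1 - β / 2 ^ 15 ≤ (β ^ 2 / 2 ^ 31) ^ ((1 / 2 ^ 21 : ℝ) * β ^ 2) := by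
    rw [Real.rpow_def_of_pos hδ]
    refine le_trans ?_ (Real.add_one_le_exp _)
    have h2 : -64 / β * (1 / 2 ^ 21 * β ^ 2) ≤
        Real.log (β ^ 2 / 2 ^ 31) * (1 / 2 ^ 21 * β ^ 2) := by gcongr
    have h3 : -64 / β * (1 / 2 ^ 21 * β ^ 2) = -(β / 2 ^ 15) := by
      field_simp
      norm_num
    linarith
  calc (1 : ℝ) ≤ (1 + β / 2 ^ 14) * (1 - β / 2 ^ 15) := by nlinarith
    _ ≤ _ := by gcongr

theorem isWiggly_of_lt_betaPrime {E : Type*} [NormedAddCommGroup E] [NormedSpace ℝ E]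
    {ι : X → E} (hι : Isometry ι) {β r₀ : ℝ} (hβ : 0 ≤ β)
    (h : ∀ (x : X) (r : ℝ), 0 < r → r < r₀ →
      ENNReal.ofReal β < betaPrime (Set.range ι) (ι x) r) : IsWiggly X β r₀ := by
  intro x r hr hr₀ u n hu d η κ hd hη hκ hdist hlen hsum
  obtain ⟨_, ⟨z, rfl⟩, hz, hfar⟩ := exists_far_from_chain hβ (h x r hr hr₀) (u := ι ∘ u) (n := n)
    (by simpa [hι.dist_eq] using hu) hd hη hκ (by simpa [hι.dist_eq] using hdist)
    (by simpa [hι.dist_eq, chainLength] using hlen) hsum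
  refine ⟨z, by simpa [hι.dist_eq] using hz, by simpa [hι.dist_eq] using hfar⟩

end Subdivision

/-! ### Conclusion. -/

theorem theorem1p3 :
    ∃ c₀ : ℝ, 0 < c₀ ∧
      ∀ (X : Type*) [MetricSpace X] [CompactSpace X] [ConnectedSpace X]
        (ι : X → EllInfty), Isometry ι →
        ∀ (β r₀ : ℝ), 0 < β → 0 < r₀ →
          (∀ (x : X) (r : ℝ), 0 < r → r < r₀ →
            ENNReal.ofReal β < betaPrime (Set.range ι) (ι x) r) →
          ENNReal.ofReal (1 + c₀ * β ^ 2) ≤ dimH (Set.univ : Set X) := by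
  refine ⟨1 / 2 ^ 21, by positivity, fun X _ _ _ ι hι β r₀ hβ hr₀ h => ?_⟩
  obtain ⟨x⟩ := (inferInstance : Nonempty X)
  have hE : Nontrivial EllInfty :=
    ⟨lp.single ∞ 0 (1 : ℝ), 0, fun h0 => by
      have := congrArg (fun g : EllInfty => g 0) h0
      simp at this⟩
  obtain ⟨hβ2, _, ⟨y, rfl⟩, hyx⟩ :=
    lt_two_of_lt_betaPrime (half_pos hr₀) hβ.le (h x (r₀ / 2) (half_pos hr₀) (half_lt_self hr₀))
  have hyx' : 0 < dist y x := dist_pos.2 fun h0 => hyx (h0 ▸ rfl)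
  have hX := isWiggly_of_lt_betaPrime hι hβ.le h
  -- The initial piece is the closed ball of radius `w` around `x`, which misses `y`.
  obtain ⟨w, hw⟩ : ∃ w, w = min r₀ (dist y x / 2) := ⟨_, rfl⟩
  have hw0 : 0 < w := by rw [hw]; positivity
  have hw1 : w ≤ r₀ := hw ▸ min_le_left _ _
  have hw2 : w < dist y x := by
    have : w ≤ dist y x / 2 := hw ▸ min_le_right _ _
    linarith
  refine le_dimH_of_hasSubdivision (P := IsPiece) (w₀ := w) (δ := β ^ 2 / 2 ^ 31) (θ := 7 / 8)
    (ε := β / 2 ^ 14) (by positivity) (by norm_num) (by positivity) (one_le_gain hβ hβ2)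
    (fun _ _ => IsPiece.pos) (fun _ _ => IsPiece.nonempty) ?_
    (fun Q w' hQ hw' => hasSubdivision_of_isWiggly hX hβ hβ2 hQ (by linarith)) (by norm_num)
    ⟨_, 0, w, isCrossing_closedBall hw0 hw2, sub_zero w⟩ le_rfl
  rintro Q _ ⟨f, a, b, hQ, -⟩
  exact hQ.isClosed
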